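/- Let $k$ be an infinite field of arbitrary characteristic, let $n, d \ge 0$ be integers, and let $S = k[x_0, \ldots, x_n]$ with its standard grading and $\mathfrak m = (x_0, \ldots, x_n)$. Let $I_1, \ldots, I_d \subseteq S$ be the ideals of $d$ linear subspaces $\mathbb P(W_1), \ldots, \mathbb P(W_d)$ of $\mathbb P^n$, where $W_1, \ldots, W_d$ are vector subspaces of $k^{n+1}$ and $I_i$ is the ideal of all polynomials vanishing on $W_i$; let $L \subseteq S$ be any ideal generated by linear forms. Then the ideal \[ I_1 \cap \cdots \cap I_d + L \] (that is, $(I_1 \cap \cdots \cap I_d) + L$, the empty intersection being $S$) is $d$-regular in the sense of Castelnuovo and Mumford: it has a minimal graded free resolution \[ \cdots \longrightarrow \bigoplus_{\alpha} S(-e_{\alpha,1}) \longrightarrow \bigoplus_{\alpha} S(-e_{\alpha,0}) \longrightarrow I_1 \cap \cdots \cap I_d + L \longrightarrow 0 \] (finitely generated graded free modules $F_i=\bigoplus_\alpha S(-e_{\alpha,i})$, graded maps of degree zero, exactness, and the image of $F_{i+1}\to F_i$ contained in $\mathfrak m F_i$) with $e_{\alpha, i} \le d + i$ for all $\alpha$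 and $i$. -/

import Mathlib

/-- The degree `j` part of the polynomial ring `k[x_0, …, x_n]`, for an arbitrary integer `j`
(it is zero for `j < 0`). -/
noncomputable def polyDegreePart (k : Type*) [Field k] (n : ℕ) (j : ℤ) :
    Submodule k (MvPolynomial (Fin (n + 1)) k) :=
  if 0 ≤ j then MvPolynomial.homogeneousSubmodule (Fin (n + 1)) k j.toNat else ⊥

/-- The degree `j` part of the graded free module `⊕_α S(-e_α)`, where `S = k[x_0, …, x_n]`:
the vectors whose `α`-th coordinate is homogeneous of degree `j - e_α`. -/
noncomputable def freeDegreePart (k : Type*) [Field k] (n : ℕ) {r : ℕ} (e : Fin r → ℤ) (j : ℤ) :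
    Submodule k (Fin r → MvPolynomial (Fin (n + 1)) k) :=
  Submodule.pi Set.univ (fun α => polyDegreePart k n (j - e α))

/-- The irrelevant maximal ideal `𝔪 = (x_0, …, x_n)`. -/
noncomputable def irrelevantMaximalIdeal (k : Type*) [Field k] (n : ℕ) : Ideal (MvPolynomial (Fin (n + 1)) k) :=
  Ideal.span (Set.range MvPolynomial.X)

/-- A minimal resolution of a graded `S`-module `M` (whose degree `j` part is `ℳ j`) by finitely
generated graded free `S`-modules `F_i = ⊕_α S(-e_{α,i})`, where `S = k[x_0, …, x_n]`:
an exact sequence `⋯ ⟶ F_1 ⟶ F_0 ⟶ M ⟶ 0` of graded maps of degree zero such that the image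
of `F_{i+1} ⟶ F_i` lies in `𝔪 F_i`.  The ranks may be zero from some point on (by the Hilbert
syzygy theorem they automatically are). -/
structure MinimalGradedFreeResolution (k : Type*) [Field k] (n : ℕ) (M : Type*) [AddCommGroup M]
    [Module k M] [Module (MvPolynomial (Fin (n + 1)) k) M]
    [IsScalarTower k (MvPolynomial (Fin (n + 1)) k) M] (ℳ : ℤ → Submodule k M) where
  /-- the rank of `F_i` -/
  rank : ℕ → ℕ
  /-- the degrees `e_{α,i}` of the generators of `F_i` -/
  deg : (i : ℕ) → Fin (rank i) → ℤ
  /-- the augmentation `F_0 ⟶ M` -/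
  aug : (Fin (rank 0) → MvPolynomial (Fin (n + 1)) k) →ₗ[MvPolynomial (Fin (n + 1)) k] M
  /-- the differential `F_{i+1} ⟶ F_i` -/
  diff : (i : ℕ) → (Fin (rank (i + 1)) → MvPolynomial (Fin (n + 1)) k)
    →ₗ[MvPolynomial (Fin (n + 1)) k] (Fin (rank i) → MvPolynomial (Fin (n + 1)) k)
  aug_graded : ∀ (j : ℤ), ∀ v ∈ freeDegreePart k n (deg 0) j, aug v ∈ ℳ j
  diff_graded : ∀ (i : ℕ) (j : ℤ), ∀ v ∈ freeDegreePart k n (deg (i + 1)) j,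
    diff i v ∈ freeDegreePart k n (deg i) j
  aug_surjective : Function.Surjective aug
  exact_zero : Function.Exact (diff 0) aug
  exact_succ : ∀ i : ℕ, Function.Exact (diff (i + 1)) (diff i)
  minimal : ∀ i : ℕ, LinearMap.range (diff i) ≤
    irrelevantMaximalIdeal k n •
      (⊤ : Submodule (MvPolynomial (Fin (n + 1)) k) (Fin (rank i) → MvPolynomial (Fin (n + 1)) k))

/-- The graded module `M` is `r`-regular (in the sense of Castelnuovo and Mumford): it has a minimal
graded free resolution with `e_{α,i} ≤ r + i` for all `α` and `i`. (Minimal graded free resolutions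
are unique up to isomorphism, so one of them has this property if and only if all have it.) -/
def IsCMRegular (k : Type*) [Field k] (n : ℕ) (M : Type*) [AddCommGroup M]
    [Module k M] [Module (MvPolynomial (Fin (n + 1)) k) M]
    [IsScalarTower k (MvPolynomial (Fin (n + 1)) k) M] (ℳ : ℤ → Submodule k M) (r : ℤ) : Prop :=
  ∃ F : MinimalGradedFreeResolution k n M ℳ,
    ∀ (i : ℕ) (α : Fin (F.rank i)), F.deg i α ≤ r + i

/-- The degree `j` part `I_j = I ∩ S_j` of an ideal `I` of `S = k[x_0, …, x_n]`, in `I`. -/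
noncomputable def idealDegreePart {k : Type*} [Field k] {n : ℕ} (I : Ideal (MvPolynomial (Fin (n + 1)) k))
    (j : ℤ) : Submodule k I :=
  (polyDegreePart k n j).comap ((Submodule.subtype I).restrictScalars k)

/-- The ideal `I` of `S = k[x_0, …, x_n]` is `r`-regular, as a graded `S`-module. -/
def IsCMRegularIdeal {k : Type*} [Field k] {n : ℕ} (I : Ideal (MvPolynomial (Fin (n + 1)) k))
    (r : ℤ) : Prop :=
  IsCMRegular k n I (idealDegreePart I) r

/-- A linear ideal: an ideal generated by linear forms. -/
def IsLinearIdeal {k : Type*} [Field k] {n : ℕ} (L : Ideal (MvPolynomial (Fin (n + 1)) k)) : Prop :=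
  ∃ s : Set (MvPolynomial (Fin (n + 1)) k), (∀ f ∈ s, f.IsHomogeneous 1) ∧ L = Ideal.span s

/-- The ideal in `k[x_0, …, x_n]` of the linear subspace `ℙ(W) ⊆ ℙⁿ` given by a vector subspace
`W ⊆ k^{n+1}`: all polynomials vanishing on the cone `W` over `ℙ(W)`. -/
noncomputable def linearSpaceIdeal {k : Type*} [Field k] {n : ℕ}
    (W : Submodule k (Fin (n + 1) → k)) : Ideal (MvPolynomial (Fin (n + 1)) k) :=
  MvPolynomial.vanishingIdeal k (W : Set (Fin (n + 1) → k))

open MvPolynomial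

/-! ### Graded pieces of the polynomial ring and of free modules -/

section Graded

variable {k : Type*} [Field k] {n : ℕ}

/-! Regularity is reduced to a statement about socles: for `I = I₁ ∩ ⋯ ∩ I_d` and every linear ideal
`L`, the socle of `S / (I + L)` vanishes in degrees at least `d` (`socleBound_arrangementIdeal`).
Since a sum of linear ideals is linear, this bound survives adding further linear forms.

The socle bound is proved by induction on `d` and Noetherian induction on `L`. Let `J_i` be the
intersection omitting `I_i`, and `Q = I₁ + ⋯ + I_d + L`. If `𝔪 ⊄ Q`, the linear forms of `Q` have a
common zero `v ≠ 0`; then `I + L` is invariant under translation along `v`, a variable not vanishing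
at `v` is a nonzerodivisor modulo it, and the socle is zero. If `𝔪 ⊆ Q` and `𝔪 ⊄ L`, take a general
linear form `l ∉ L`. By the case of `L + (l)`, a socle element is `f = g + l h` with `g ∈ I + L`.
Then `l² h ∈ I + L ⊆ J_i + L`, and cancelling `l` twice (induction on `d`) gives `h ∈ J_i + L`. As
`I_i J_i ⊆ I`, this yields `Q h ⊆ I + L`, so `l h ∈ I + L`.

For regularity, the bound provides a flag of linear ideals from `0` to `𝔪`, each step adding a form
`l` injective on `S / (K + Λ)` in high degrees. For `N ⊆ F` with such a flag, `N ∩ ΛF = ΛN` in high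
degrees (`LinearFlag.mem_smul_of_mem`). Taking `Λ = 𝔪` bounds the degrees of minimal generators of
`N`, and the flag condition passes to the syzygies of `N` with the bound raised by one
(`LinearFlag.ker`), so the resolution is built step by step. -/

theorem mem_polyDegreePart_iff {j : ℤ} {f : MvPolynomial (Fin (n + 1)) k} :
    f ∈ polyDegreePart k n j ↔ f = 0 ∨ ∃ i : ℕ, (i : ℤ) = j ∧ f.IsHomogeneous i := by
  unfold polyDegreePart
  split_ifs with h
  · rw [mem_homogeneousSubmodule]
    constructor
    · intro hf
      exact Or.inr ⟨j.toNat, Int.toNat_of_nonneg h, hf⟩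
    · rintro (rfl | ⟨i, rfl, hf⟩)
      · exact isHomogeneous_zero _ _ _
      · simpa using hf
  · rw [Submodule.mem_bot]
    constructor
    · exact Or.inl
    · rintro (rfl | ⟨i, rfl, -⟩)
      · rfl
      · exact absurd (Int.natCast_nonneg i) h

theorem MvPolynomial.IsHomogeneous.mem_polyDegreePart {i : ℕ} {f : MvPolynomial (Fin (n + 1)) k}
    (hf : f.IsHomogeneous i) : f ∈ polyDegreePart k n i :=
  mem_polyDegreePart_iff.2 (Or.inr ⟨i, rfl, hf⟩)

theorem isHomogeneous_of_mem_polyDegreePart {i : ℕ} {f : MvPolynomial (Fin (n + 1)) k}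
    (hf : f ∈ polyDegreePart k n i) : f.IsHomogeneous i := by
  rcases mem_polyDegreePart_iff.1 hf with rfl | ⟨i', hi, h⟩
  · exact isHomogeneous_zero _ _ _
  · rwa [← Int.natCast_inj.1 hi]

theorem mul_mem_polyDegreePart {a b : ℤ} {f g : MvPolynomial (Fin (n + 1)) k}
    (hf : f ∈ polyDegreePart k n a) (hg : g ∈ polyDegreePart k n b) :
    f * g ∈ polyDegreePart k n (a + b) := by
  rcases mem_polyDegreePart_iff.1 hf with rfl | ⟨i, rfl, hf⟩
  · simp
  rcases mem_polyDegreePart_iff.1 hg with rfl | ⟨j, rfl, hg⟩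
  · simp
  · exact_mod_cast (hf.mul hg).mem_polyDegreePart

/-- The projection of the polynomial ring onto its degree `j` part, for an integer `j`. -/
noncomputable def polyProj (k : Type*) [Field k] (n : ℕ) (j : ℤ) :
    MvPolynomial (Fin (n + 1)) k →ₗ[k] MvPolynomial (Fin (n + 1)) k :=
  if 0 ≤ j then homogeneousComponent j.toNat else 0

theorem polyProj_natCast (i : ℕ) : polyProj k n i = homogeneousComponent i := by
  simp [polyProj]

theorem polyProj_mem (j : ℤ) (f : MvPolynomial (Fin (n + 1)) k) :
    polyProj k n j f ∈ polyDegreePart k n j := by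
  unfold polyProj polyDegreePart
  split_ifs with h
  · exact homogeneousComponent_isHomogeneous _ _
  · simp

theorem polyProj_of_mem {i j : ℤ} {f : MvPolynomial (Fin (n + 1)) k}
    (hf : f ∈ polyDegreePart k n i) : polyProj k n j f = if j = i then f else 0 := by
  rcases mem_polyDegreePart_iff.1 hf with rfl | ⟨i, rfl, hf⟩
  · simp
  · unfold polyProj
    split_ifs with h h' h'
    · subst h'
      simp [homogeneousComponent_of_mem ((mem_homogeneousSubmodule _ _).2 hf)]
    · rw [homogeneousComponent_of_mem ((mem_homogeneousSubmodule _ _).2 hf), if_neg]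
      omega
    · omega
    · rfl

theorem polyProj_mul {a : ℤ} {g : MvPolynomial (Fin (n + 1)) k} (hg : g ∈ polyDegreePart k n a)
    (j : ℤ) (f : MvPolynomial (Fin (n + 1)) k) :
    polyProj k n j (g * f) = g * polyProj k n (j - a) f := by
  rw [← sum_homogeneousComponent f, Finset.mul_sum, map_sum, map_sum, Finset.mul_sum]
  refine Finset.sum_congr rfl fun i _ => ?_
  have hi := (homogeneousComponent_isHomogeneous i f).mem_polyDegreePart
  rw [polyProj_of_mem (mul_mem_polyDegreePart hg hi), polyProj_of_mem hi]
  by_cases h : j = a + i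
  · rw [if_pos h, if_pos (by omega)]
  · rw [if_neg h, if_neg (by omega), mul_zero]

variable {r : ℕ} {e : Fin r → ℤ}

/-- The projection of a graded free module onto its degree `j` part. -/
noncomputable def freeProj (k : Type*) [Field k] (n : ℕ) {r : ℕ} (e : Fin r → ℤ) (j : ℤ) :
    (Fin r → MvPolynomial (Fin (n + 1)) k) →ₗ[k] (Fin r → MvPolynomial (Fin (n + 1)) k) :=
  LinearMap.pi fun α => polyProj k n (j - e α) ∘ₗ LinearMap.proj α

@[simp]
theorem freeProj_apply (j : ℤ) (f : Fin r → MvPolynomial (Fin (n + 1)) k) (α : Fin r) :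
    freeProj k n e j f α = polyProj k n (j - e α) (f α) := rfl

theorem mem_freeDegreePart_iff {j : ℤ} {f : Fin r → MvPolynomial (Fin (n + 1)) k} :
    f ∈ freeDegreePart k n e j ↔ ∀ α, f α ∈ polyDegreePart k n (j - e α) := by
  simp [freeDegreePart, Submodule.mem_pi]

theorem freeProj_mem (j : ℤ) (f : Fin r → MvPolynomial (Fin (n + 1)) k) :
    freeProj k n e j f ∈ freeDegreePart k n e j :=
  mem_freeDegreePart_iff.2 fun _ => polyProj_mem _ _

theorem freeProj_of_mem {j : ℤ} {f : Fin r → MvPolynomial (Fin (n + 1)) k}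
    (hf : f ∈ freeDegreePart k n e j) : freeProj k n e j f = f := by
  ext1 α
  rw [freeProj_apply, polyProj_of_mem (mem_freeDegreePart_iff.1 hf α), if_pos rfl]

theorem freeProj_smul {a : ℤ} {g : MvPolynomial (Fin (n + 1)) k} (hg : g ∈ polyDegreePart k n a)
    (j : ℤ) (f : Fin r → MvPolynomial (Fin (n + 1)) k) :
    freeProj k n e j (g • f) = g • freeProj k n e (j - a) f := by
  ext1 α
  simp only [freeProj_apply, Pi.smul_apply, smul_eq_mul]
  rw [polyProj_mul hg, sub_right_comm]

theorem smul_mem_freeDegreePart {a j : ℤ} {g : MvPolynomial (Fin (n + 1)) k}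
    (hg : g ∈ polyDegreePart k n a) {f : Fin r → MvPolynomial (Fin (n + 1)) k}
    (hf : f ∈ freeDegreePart k n e j) : g • f ∈ freeDegreePart k n e (a + j) := by
  rw [mem_freeDegreePart_iff] at *
  intro α
  rw [add_sub_assoc]
  exact mul_mem_polyDegreePart hg (hf α)

theorem freeProj_smul_right {i : ℤ} {v : Fin r → MvPolynomial (Fin (n + 1)) k}
    (hv : v ∈ freeDegreePart k n e i) (j : ℤ) (g : MvPolynomial (Fin (n + 1)) k) :
    freeProj k n e j (g • v) = polyProj k n (j - i) g • v := by
  ext1 α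
  simp only [freeProj_apply, Pi.smul_apply, smul_eq_mul]
  rw [mul_comm, polyProj_mul (mem_freeDegreePart_iff.1 hv α), mul_comm]
  congr 2
  ring_nf

/-- Every vector is the sum of finitely many of its homogeneous components. -/
theorem exists_sum_freeProj (e : Fin r → ℤ) (f : Fin r → MvPolynomial (Fin (n + 1)) k) :
    ∃ J : Finset ℤ, ∑ j ∈ J, freeProj k n e j f = f := by
  classical
  let J : Finset ℤ := Finset.univ.biUnion fun α =>
    (Finset.range ((f α).totalDegree + 1)).image fun i : ℕ => (i : ℤ) + e α
  refine ⟨J, ?_⟩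
  ext1 α
  rw [Finset.sum_apply]
  simp only [freeProj_apply]
  have hJ : (Finset.range ((f α).totalDegree + 1)).image (fun i : ℕ => (i : ℤ) + e α) ⊆ J :=
    Finset.subset_biUnion_of_mem (fun α => (Finset.range ((f α).totalDegree + 1)).image
      fun i : ℕ => (i : ℤ) + e α) (Finset.mem_univ α)
  rw [← Finset.sum_subset hJ, Finset.sum_image]
  · simp only [add_sub_cancel_right, polyProj_natCast]
    exact sum_homogeneousComponent _
  · intro a _ b _ hab
    simpa using hab
  · intro j _ hj
    by_cases h : 0 ≤ j - e α
    · lift j - e α to ℕ using h with i hi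
      rw [polyProj_natCast]
      apply homogeneousComponent_eq_zero
      by_contra hlt
      apply hj
      rw [Finset.mem_image]
      exact ⟨i, Finset.mem_range.2 (by omega), by omega⟩
    · rw [polyProj, if_neg h, LinearMap.zero_apply]

end Graded

/-! ### Linear forms and linear ideals -/

section LinearForms

variable {k : Type*} [Field k] {n : ℕ}

/-- An ideal containing the homogeneous components of its elements. -/
def IsHomogIdeal (K : Ideal (MvPolynomial (Fin (n + 1)) k)) : Prop :=
  ∀ f ∈ K, ∀ i, homogeneousComponent i f ∈ K

theorem IsHomogIdeal.sup {K L : Ideal (MvPolynomial (Fin (n + 1)) k)} (hK : IsHomogIdeal K)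
    (hL : IsHomogIdeal L) : IsHomogIdeal (K ⊔ L) := by
  intro f hf i
  obtain ⟨g, hg, h, hh, rfl⟩ := Submodule.mem_sup.1 hf
  rw [map_add]
  exact Submodule.add_mem_sup (hK g hg i) (hL h hh i)

theorem isHomogIdeal_span {s : Set (MvPolynomial (Fin (n + 1)) k)} {d : ℕ}
    (hs : ∀ f ∈ s, f.IsHomogeneous d) : IsHomogIdeal (Ideal.span s) := by
  let _ : GradedAlgebra (homogeneousSubmodule (Fin (n + 1)) k) := MvPolynomial.gradedAlgebra
  intro f hf i
  exact homogeneousComponent_mem_of_mem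
    (Ideal.homogeneous_span (homogeneousSubmodule (Fin (n + 1)) k) s
      fun x hx => ⟨d, hs x hx⟩) hf i

theorem IsLinearIdeal.isHomogIdeal {L : Ideal (MvPolynomial (Fin (n + 1)) k)}
    (hL : IsLinearIdeal L) : IsHomogIdeal L := by
  obtain ⟨s, hs, rfl⟩ := hL
  exact isHomogIdeal_span hs

theorem IsLinearIdeal.sup_span_singleton {L : Ideal (MvPolynomial (Fin (n + 1)) k)}
    (hL : IsLinearIdeal L) {l : MvPolynomial (Fin (n + 1)) k} (hl : l.IsHomogeneous 1) :
    IsLinearIdeal (L ⊔ Ideal.span {l}) := by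
  obtain ⟨s, hs, rfl⟩ := hL
  refine ⟨s ∪ {l}, ?_, (Ideal.span_union _ _).symm⟩
  rintro f (hf | rfl)
  exacts [hs f hf, hl]

theorem isLinearIdeal_bot : IsLinearIdeal (⊥ : Ideal (MvPolynomial (Fin (n + 1)) k)) :=
  ⟨∅, by simp, by simp⟩

theorem IsLinearIdeal.le_irrelevant {L : Ideal (MvPolynomial (Fin (n + 1)) k)}
    (hL : IsLinearIdeal L) : L ≤ irrelevantMaximalIdeal k n := by
  obtain ⟨s, hs, rfl⟩ := hL
  refine Ideal.span_le.2 fun f hf => ?_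
  have h := (mem_homogeneousSubmodule 1 f).2 (hs f hf)
  rw [homogeneousSubmodule_one_eq_span_X] at h
  exact Submodule.span_subset_span k _ _ h

theorem mem_irrelevantMaximalIdeal_iff {f : MvPolynomial (Fin (n + 1)) k} :
    f ∈ irrelevantMaximalIdeal k n ↔ f.coeff 0 = 0 := by
  unfold irrelevantMaximalIdeal
  constructor
  · intro hf
    have : Ideal.span (Set.range X) ≤ RingHom.ker (constantCoeff (R := k) (σ := Fin (n + 1))) := by
      refine Ideal.span_le.2 ?_
      rintro _ ⟨a, rfl⟩
      simp [RingHom.mem_ker]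
    exact this hf
  · intro hf
    rw [← Set.image_univ, mem_ideal_span_X_image]
    intro m hm
    by_contra! h
    have : m = 0 := by
      ext a
      simpa using h a (Set.mem_univ a)
    subst this
    simp_all

theorem MvPolynomial.IsHomogeneous.mem_irrelevant {f : MvPolynomial (Fin (n + 1)) k} {i : ℕ}
    (hf : f.IsHomogeneous i) (hi : 0 < i) : f ∈ irrelevantMaximalIdeal k n :=
  mem_irrelevantMaximalIdeal_iff.2 (hf.coeff_eq_zero (by simp; omega))

/-- The linear form with a given coefficient vector. -/
noncomputable def linForm (k : Type*) [Field k] (n : ℕ) :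
    (Fin (n + 1) → k) →ₗ[k] MvPolynomial (Fin (n + 1)) k :=
  Fintype.linearCombination k X

theorem linForm_apply (c : Fin (n + 1) → k) : linForm k n c = ∑ a, c a • X a :=
  Fintype.linearCombination_apply _ _ _

theorem linForm_isHomogeneous (c : Fin (n + 1) → k) : (linForm k n c).IsHomogeneous 1 := by
  rw [linForm_apply, ← mem_homogeneousSubmodule]
  exact Submodule.sum_mem _ fun a _ => Submodule.smul_mem _ _ (isHomogeneous_X k a)

theorem linForm_single (a : Fin (n + 1)) : linForm k n (Pi.single a 1) = X a := by
  rw [linForm_apply, Finset.sum_eq_single a] <;> simp +contextual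

theorem exists_linForm_eq {l : MvPolynomial (Fin (n + 1)) k} (hl : l.IsHomogeneous 1) :
    ∃ c, linForm k n c = l := by
  rw [← mem_homogeneousSubmodule, homogeneousSubmodule_one_eq_span_X] at hl
  rw [← LinearMap.mem_range, linForm, Fintype.range_linearCombination]
  exact hl

theorem eval_linForm (c v : Fin (n + 1) → k) : eval v (linForm k n c) = ∑ a, c a * v a := by
  simp [linForm_apply, smul_eval]

theorem apply_eq_sum_single (φ : (Fin (n + 1) → k) →ₗ[k] k) (b : Fin (n + 1) → k) :
    φ b = ∑ a, b a * φ (Pi.single a 1) := by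
  rw [LinearMap.pi_apply_eq_sum_univ φ b]
  refine Finset.sum_congr rfl fun a _ => ?_
  rw [smul_eq_mul]
  congr 2
  ext j
  simp [Pi.single_apply, eq_comm]

/-- A linear form outside an ideal does not vanish at some common zero of the linear forms in
the ideal. -/
theorem exists_eval_ne_zero {Q : Ideal (MvPolynomial (Fin (n + 1)) k)}
    {l : MvPolynomial (Fin (n + 1)) k} (hl : l.IsHomogeneous 1) (hlQ : l ∉ Q) :
    ∃ v : Fin (n + 1) → k, eval v l ≠ 0 ∧ ∀ f ∈ Q, f.IsHomogeneous 1 → eval v f = 0 := by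
  obtain ⟨c, rfl⟩ := exists_linForm_eq hl
  let P : Submodule k (Fin (n + 1) → k) := (Q.restrictScalars k).comap (linForm k n)
  -- A functional on coefficient vectors, here separating `c` from the linear forms of `Q`, is
  -- evaluation at a point.
  obtain ⟨φ, hφ, hP⟩ := Submodule.exists_le_ker_of_notMem (p := P) (v := c) hlQ
  have key : ∀ b, eval (fun a => φ (Pi.single a 1)) (linForm k n b) = φ b := by
    intro b
    rw [eval_linForm, apply_eq_sum_single]
  refine ⟨fun a => φ (Pi.single a 1), by rwa [key], fun f hf hf1 => ?_⟩
  obtain ⟨b, rfl⟩ := exists_linForm_eq hf1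
  rw [key]
  exact hP hf

theorem mem_linearSpaceIdeal_iff {W : Submodule k (Fin (n + 1) → k)}
    {f : MvPolynomial (Fin (n + 1)) k} :
    f ∈ linearSpaceIdeal W ↔ ∀ w ∈ W, eval w f = 0 :=
  Iff.rfl

theorem exists_linForm_notVanishing {W : Submodule k (Fin (n + 1) → k)} {v : Fin (n + 1) → k}
    (hv : v ∉ W) : ∃ l ∈ linearSpaceIdeal W, l.IsHomogeneous 1 ∧ eval v l ≠ 0 := by
  obtain ⟨φ, hφ, hW⟩ := Submodule.exists_le_ker_of_notMem hv
  have key : ∀ w, eval w (linForm k n fun a => φ (Pi.single a 1)) = φ w := by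
    intro w
    rw [eval_linForm, apply_eq_sum_single]
    exact Finset.sum_congr rfl fun a _ => mul_comm _ _
  refine ⟨linForm k n fun a => φ (Pi.single a 1), ?_, linForm_isHomogeneous _, by rwa [key]⟩
  rw [mem_linearSpaceIdeal_iff]
  intro w hw
  rw [key]
  exact hW hw

end LinearForms

/-! ### Translation invariance and nonzerodivisors -/

section Translation

variable {k : Type*} [Field k] {n : ℕ}

/-- Translation of a polynomial along the line through a vector `v`, with parameter `t`:
the substitution `x ↦ x + t v`. -/
noncomputable def translatePoly (v : Fin (n + 1) → k) :
    MvPolynomial (Fin (n + 1)) k →ₐ[k] Polynomial (MvPolynomial (Fin (n + 1)) k) :=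
  aeval fun a => Polynomial.C (X a) + Polynomial.C (C (v a)) * Polynomial.X

/-- An ideal invariant under translation along `v`. -/
def IsTranslationStable (v : Fin (n + 1) → k) (K : Ideal (MvPolynomial (Fin (n + 1)) k)) : Prop :=
  ∀ f ∈ K, translatePoly v f ∈ K.map Polynomial.C

theorem IsTranslationStable.sup {v : Fin (n + 1) → k}
    {K L : Ideal (MvPolynomial (Fin (n + 1)) k)} (hK : IsTranslationStable v K)
    (hL : IsTranslationStable v L) : IsTranslationStable v (K ⊔ L) := by
  intro f hf
  obtain ⟨g, hg, h, hh, rfl⟩ := Submodule.mem_sup.1 hf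
  rw [map_add, Ideal.map_sup]
  exact Submodule.add_mem_sup (hK g hg) (hL h hh)

theorem translatePoly_linForm (v c : Fin (n + 1) → k) :
    translatePoly v (linForm k n c) =
      Polynomial.C (linForm k n c) + Polynomial.C (C (eval v (linForm k n c))) * Polynomial.X := by
  rw [eval_linForm, linForm_apply, map_sum, map_sum, map_sum, map_sum, Finset.sum_mul,
    ← Finset.sum_add_distrib]
  refine Finset.sum_congr rfl fun a _ => ?_
  rw [MvPolynomial.smul_eq_C_mul, map_mul, map_mul, translatePoly, aeval_X, map_mul, map_mul,
    algHom_C, Polynomial.algebraMap_apply, MvPolynomial.algebraMap_eq]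
  ring

theorem IsLinearIdeal.isTranslationStable {L : Ideal (MvPolynomial (Fin (n + 1)) k)}
    (hL : IsLinearIdeal L) {v : Fin (n + 1) → k}
    (hv : ∀ f ∈ L, f.IsHomogeneous 1 → eval v f = 0) : IsTranslationStable v L := by
  obtain ⟨s, hs, rfl⟩ := hL
  suffices h : Ideal.span s ≤ ((Ideal.span s).map Polynomial.C).comap (translatePoly v) from
    fun f hf => h hf
  refine Ideal.span_le.2 fun f hf => ?_
  obtain ⟨c, rfl⟩ := exists_linForm_eq (hs f hf)
  have hmem : linForm k n c ∈ Ideal.span s := Ideal.subset_span hf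
  change translatePoly v (linForm k n c) ∈ (Ideal.span s).map Polynomial.C
  rw [translatePoly_linForm, hv _ hmem (hs _ hf)]
  simpa using Ideal.mem_map_of_mem Polynomial.C hmem

theorem eval_map_translatePoly (v w : Fin (n + 1) → k) (t : k) (f : MvPolynomial (Fin (n + 1)) k) :
    ((translatePoly v f).map (eval w)).eval t = eval (fun a => w a + t * v a) f := by
  have : ((Polynomial.evalRingHom t).comp
      ((Polynomial.mapRingHom (eval w)).comp (translatePoly v).toRingHom)) =
      eval (fun a => w a + t * v a) := by
    refine MvPolynomial.ringHom_ext (fun a => ?_) fun a => ?_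
    · simp [translatePoly]
    · simp [translatePoly, mul_comm t]
  exact congrArg (fun φ : _ →+* k => φ f) this

/-- For `w ∈ W` the polynomial `f(w + t v)` in `t` vanishes at every element of the infinite field,
so each of its coefficients vanishes at `w`. -/
theorem isTranslationStable_linearSpaceIdeal [Infinite k] {W : Submodule k (Fin (n + 1) → k)}
    {v : Fin (n + 1) → k} (hv : v ∈ W) : IsTranslationStable v (linearSpaceIdeal W) := by
  intro f hf
  rw [Ideal.mem_map_C_iff]
  intro m
  rw [mem_linearSpaceIdeal_iff] at *
  intro w hw
  rw [← Polynomial.coeff_map]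
  suffices h : (translatePoly v f).map (eval w) = 0 by rw [h, Polynomial.coeff_zero]
  refine Polynomial.funext fun t => ?_
  rw [eval_map_translatePoly, Polynomial.eval_zero]
  exact hf _ (W.add_mem hw (W.smul_mem t hv))

theorem IsTranslationStable.iInf {ι : Sort*} {v : Fin (n + 1) → k}
    {K : ι → Ideal (MvPolynomial (Fin (n + 1)) k)} (hK : ∀ i, IsTranslationStable v (K i)) :
    IsTranslationStable v (⨅ i, K i) := by
  intro f hf
  rw [Ideal.mem_map_C_iff]
  intro m
  rw [Ideal.mem_iInf] at *
  exact fun i => Ideal.mem_map_C_iff.1 (hK i f (hf i)) m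

theorem coeff_zero_translatePoly (v : Fin (n + 1) → k) (f : MvPolynomial (Fin (n + 1)) k) :
    (translatePoly v f).coeff 0 = f := by
  rw [← Polynomial.constantCoeff_apply]
  have : Polynomial.constantCoeff.comp (translatePoly v).toRingHom = RingHom.id _ := by
    refine MvPolynomial.ringHom_ext (fun a => ?_) fun a => ?_
    · simp [translatePoly]
    · simp [translatePoly]
  exact congrArg (fun φ : _ →+* _ => φ f) this

/-- A linear form not vanishing at `v` is a nonzerodivisor modulo an ideal that is invariant under
translation along `v`. -/
theorem IsTranslationStable.mem_of_mul_mem {v : Fin (n + 1) → k}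
    {K : Ideal (MvPolynomial (Fin (n + 1)) k)} (hK : IsTranslationStable v K)
    {l f : MvPolynomial (Fin (n + 1)) k} (hl : l.IsHomogeneous 1) (hlv : eval v l ≠ 0)
    (hlf : l * f ∈ K) : f ∈ K := by
  obtain ⟨c, rfl⟩ := exists_linForm_eq hl
  set l := linForm k n c
  let π := Ideal.Quotient.mk K
  have hmap : ∀ p : Polynomial (MvPolynomial (Fin (n + 1)) k),
      p ∈ K.map Polynomial.C → p.map π = 0 := by
    intro p hp
    ext m
    rw [Polynomial.coeff_map, Polynomial.coeff_zero, Ideal.Quotient.eq_zero_iff_mem]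
    exact Ideal.mem_map_C_iff.1 hp m
  have h := hmap _ (hK _ hlf)
  set u := eval v l
  -- The translate `l + t l(v)` is the unit `l(v)` times a monic polynomial in `t`, hence a
  -- nonzerodivisor over `S / K`. So the translate of `f` is zero there, and its constant term is
  -- `f`.
  let q : Polynomial (MvPolynomial (Fin (n + 1)) k) :=
    Polynomial.X + Polynomial.C (C u⁻¹ * l)
  have hq : translatePoly v l = Polynomial.C (C u) * q := by
    rw [translatePoly_linForm, mul_add, ← map_mul, ← mul_assoc, ← map_mul, mul_inv_cancel₀ hlv,
      map_one, one_mul, add_comm (Polynomial.C _)]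
  have hmonic : (q.map π).Monic := (Polynomial.monic_X_add_C _).map π
  rw [map_mul, hq, Polynomial.map_mul, Polynomial.map_mul, Polynomial.map_C, mul_assoc] at h
  have h2 : q.map π * (translatePoly v f).map π = 0 := by
    have h3 := congrArg (fun p => Polynomial.C (π (C u⁻¹)) * p) h
    simp only [mul_zero, ← mul_assoc, ← map_mul, inv_mul_cancel₀ hlv, map_one, one_mul] at h3
    exact h3
  rw [hmonic.mul_right_eq_zero_iff] at h2
  rw [← Ideal.Quotient.eq_zero_iff_mem, ← coeff_zero_translatePoly v f, ← Polynomial.coeff_map, h2,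
    Polynomial.coeff_zero]

/-- A linear form outside an ideal generated by linear forms is a nonzerodivisor modulo it. -/
theorem IsLinearIdeal.mem_of_mul_mem {L : Ideal (MvPolynomial (Fin (n + 1)) k)}
    (hL : IsLinearIdeal L) {l f : MvPolynomial (Fin (n + 1)) k} (hl : l.IsHomogeneous 1)
    (hlL : l ∉ L) (hlf : l * f ∈ L) : f ∈ L := by
  obtain ⟨v, hv, hvL⟩ := exists_eval_ne_zero hl hlL
  exact (hL.isTranslationStable hvL).mem_of_mul_mem hl hv hlf

end Translation

/-! ### Socle bounds and general linear forms -/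

section Socle

variable {k : Type*} [Field k] {n : ℕ}

/-- The socle of `S / K` lives in degrees less than `r`. -/
def SocleBound (K : Ideal (MvPolynomial (Fin (n + 1)) k)) (r : ℕ) : Prop :=
  ∀ j, r ≤ j → ∀ f : MvPolynomial (Fin (n + 1)) k, f.IsHomogeneous j →
    (∀ a, X a * f ∈ K) → f ∈ K

theorem SocleBound.mem_of_pow_mul_mem {K : Ideal (MvPolynomial (Fin (n + 1)) k)} {r : ℕ}
    (hK : SocleBound K r) (N : ℕ) : ∀ j, r ≤ j → ∀ f : MvPolynomial (Fin (n + 1)) k,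
    f.IsHomogeneous j → (∀ g ∈ irrelevantMaximalIdeal k n ^ N, g * f ∈ K) → f ∈ K := by
  induction N with
  | zero => exact fun j _ f _ h => by simpa using h 1 (by simp)
  | succ N ih =>
    intro j hj f hf h
    refine hK j hj f hf fun a => ?_
    refine ih (1 + j) (by omega) _ ((isHomogeneous_X k a).mul hf) fun g hg => ?_
    rw [← mul_assoc]
    refine h _ ?_
    rw [pow_succ]
    exact Ideal.mul_mem_mul hg (Ideal.subset_span ⟨a, rfl⟩)

/-- Minimal primes over the annihilator of the class of `f` are associated primes of `S / K`
containing `l`, so they contain `𝔪`. Hence a power of `𝔪` kills that class, and the socle bound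
strips off the power one factor at a time. -/
theorem SocleBound.mem_of_mul_mem {K : Ideal (MvPolynomial (Fin (n + 1)) k)} {r : ℕ}
    (hK : SocleBound K r) {l : MvPolynomial (Fin (n + 1)) k}
    (hl : ∀ p ∈ associatedPrimes (MvPolynomial (Fin (n + 1)) k) (MvPolynomial (Fin (n + 1)) k ⧸ K),
      l ∈ p → irrelevantMaximalIdeal k n ≤ p)
    {j : ℕ} (hj : r ≤ j) {f : MvPolynomial (Fin (n + 1)) k} (hf : f.IsHomogeneous j)
    (hlf : l * f ∈ K) : f ∈ K := by
  let M := Submodule.span (MvPolynomial (Fin (n + 1)) k) {Ideal.Quotient.mk K f}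
  have hann : ∀ g, g ∈ Module.annihilator (MvPolynomial (Fin (n + 1)) k) M ↔ g * f ∈ K := by
    intro g
    change g ∈ M.annihilator ↔ _
    rw [Submodule.mem_annihilator_span_singleton, ← Ideal.Quotient.eq_zero_iff_mem, map_mul]
    rfl
  have hrad : irrelevantMaximalIdeal k n ≤
      (Module.annihilator (MvPolynomial (Fin (n + 1)) k) M).radical := by
    rw [← Ideal.sInf_minimalPrimes]
    refine le_sInf fun p hp => ?_
    refine hl p ?_ (hp.1.2 ((hann l).2 hlf))
    exact associatedPrimes.subset_of_injective (f := M.subtype) M.injective_subtype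
      (Module.associatedPrimes.minimalPrimes_annihilator_subset_associatedPrimes _ _ hp)
  obtain ⟨N, hN⟩ := Ideal.exists_pow_le_of_le_radical_of_fg hrad
    (IsNoetherian.noetherian _)
  exact hK.mem_of_pow_mul_mem N j hj f hf fun g hg => (hann g).1 (hN hg)

/-- A general linear form avoids a given proper ideal of linear forms and is a nonzerodivisor in
high degrees modulo finitely many ideals. -/
theorem exists_general_linForm [Infinite k] {ι : Type*} (T : Finset ι)
    (K : ι → Ideal (MvPolynomial (Fin (n + 1)) k)) {r : ℕ} (hK : ∀ i ∈ T, SocleBound (K i) r)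
    {L : Ideal (MvPolynomial (Fin (n + 1)) k)} (hL : ¬ irrelevantMaximalIdeal k n ≤ L) :
    ∃ l : MvPolynomial (Fin (n + 1)) k, l.IsHomogeneous 1 ∧ l ∉ L ∧
      ∀ i ∈ T, ∀ j, r ≤ j → ∀ f : MvPolynomial (Fin (n + 1)) k, f.IsHomogeneous j →
        l * f ∈ K i → f ∈ K i := by
  classical
  -- `L` may join the primes to be avoided without being prime: only spaces of linear forms matter,
  -- and a vector space over an infinite field is not a finite union of proper subspaces.
  let P : Set (Ideal (MvPolynomial (Fin (n + 1)) k)) :=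
    insert L (⋃ i ∈ T, associatedPrimes (MvPolynomial (Fin (n + 1)) k)
      (MvPolynomial (Fin (n + 1)) k ⧸ K i) ∩ {p | ¬ irrelevantMaximalIdeal k n ≤ p})
  have hfin : P.Finite := by
    refine Set.Finite.insert _ (Set.Finite.biUnion T.finite_toSet fun i _ => ?_)
    exact (associatedPrimes.finite _ _).inter_of_left _
  have hP : ∀ p ∈ P, ¬ irrelevantMaximalIdeal k n ≤ p := by
    rintro p (rfl | hp)
    · exact hL
    · simp only [Set.mem_iUnion] at hp
      obtain ⟨i, -, -, hp⟩ := hp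
      exact hp
  let φ : Ideal (MvPolynomial (Fin (n + 1)) k) → Submodule k (Fin (n + 1) → k) :=
    fun p => (p.restrictScalars k).comap (linForm k n)
  have htop : (⊤ : Submodule k (Fin (n + 1) → k)) ∉ hfin.toFinset.image φ := by
    rw [Finset.mem_image]
    rintro ⟨p, hp, hpt⟩
    refine hP p (hfin.mem_toFinset.1 hp) (Ideal.span_le.2 ?_)
    rintro _ ⟨a, rfl⟩
    have : Pi.single a 1 ∈ φ p := hpt ▸ Submodule.mem_top
    rw [← linForm_single]
    exact this
  have hne := Subspace.biUnion_ne_univ_of_top_notMem htop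
  obtain ⟨c, hc⟩ := (Set.ne_univ_iff_exists_notMem _).1 hne
  have hc' : ∀ p ∈ P, linForm k n c ∉ p := by
    intro p hp hcp
    refine hc (Set.mem_biUnion (Finset.mem_image_of_mem φ (hfin.mem_toFinset.2 hp)) ?_)
    exact hcp
  refine ⟨linForm k n c, linForm_isHomogeneous c, hc' L (Set.mem_insert _ _), ?_⟩
  intro i hi j hj f hf hlf
  refine (hK i hi).mem_of_mul_mem (fun p hp hlp => ?_) hj hf hlf
  by_contra hnp
  exact hc' p (Set.mem_insert_of_mem _ (Set.mem_biUnion hi ⟨hp, hnp⟩)) hlp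

end Socle

/-! ### The socle bound for subspace arrangements -/

section Arrangements

theorem MvPolynomial.IsHomogeneous.eval_smul_eq {k : Type*} [Field k] {n i : ℕ}
    {f : MvPolynomial (Fin (n + 1)) k} (hf : f.IsHomogeneous i) (t : k) (w : Fin (n + 1) → k) :
    eval (t • w) f = t ^ i * eval w f := by
  rw [eval_eq, eval_eq, Finset.mul_sum]
  refine Finset.sum_congr rfl fun m hm => ?_
  simp only [Pi.smul_apply, smul_eq_mul, mul_pow, Finset.prod_mul_distrib]
  rw [Finset.prod_pow_eq_pow_sum, ← hf.degree_eq_sum_deg_support hm]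
  ring

theorem IsHomogIdeal.exists_add_mul {k : Type*} [Field k] {n : ℕ}
    {K : Ideal (MvPolynomial (Fin (n + 1)) k)} (hK : IsHomogIdeal K)
    {l f : MvPolynomial (Fin (n + 1)) k} (hl : l.IsHomogeneous 1) {j : ℕ}
    (hf : f.IsHomogeneous (j + 1)) (hfK : f ∈ K ⊔ Ideal.span {l}) :
    ∃ g ∈ K, ∃ h : MvPolynomial (Fin (n + 1)) k, h.IsHomogeneous j ∧ g + l * h = f := by
  obtain ⟨g, hg, _, hm, rfl⟩ := Submodule.mem_sup.1 hfK
  obtain ⟨h, rfl⟩ := Ideal.mem_span_singleton'.1 hm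
  refine ⟨homogeneousComponent (j + 1) g, hK g hg _, homogeneousComponent j h,
    homogeneousComponent_isHomogeneous _ _, ?_⟩
  have := homogeneousComponent_of_mem (m := j + 1) ((mem_homogeneousSubmodule _ _).2 hf)
  rw [if_pos rfl, map_add, mul_comm h l] at this
  conv_rhs => rw [mul_comm h l, ← this]
  congr 1
  rw [← polyProj_natCast (j + 1), polyProj_mul hl.mem_polyDegreePart, ← polyProj_natCast j]
  congr 2
  push_cast
  ring_nf

variable {k : Type*} [Field k] [Infinite k] {n : ℕ}

/-- For `w ∈ W`, the values at `w` of the components of `f` are the coefficients of `f(t w)`, which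
vanishes for all `t` in the infinite field. -/
theorem isHomogIdeal_linearSpaceIdeal (W : Submodule k (Fin (n + 1) → k)) :
    IsHomogIdeal (linearSpaceIdeal W) := by
  intro f hf i
  rw [mem_linearSpaceIdeal_iff] at *
  intro w hw
  let p : Polynomial k := ∑ i ∈ Finset.range (f.totalDegree + 1),
    Polynomial.monomial i (eval w (homogeneousComponent i f))
  have hp : p = 0 := by
    refine Polynomial.funext fun t => ?_
    rw [Polynomial.eval_zero, ← hf (t • w) (W.smul_mem t hw), Polynomial.eval_finsetSum]
    conv_rhs => rw [← sum_homogeneousComponent f, map_sum]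
    refine Finset.sum_congr rfl fun i _ => ?_
    rw [Polynomial.eval_monomial, (homogeneousComponent_isHomogeneous i f).eval_smul_eq, mul_comm]
  have := congrArg (fun q => Polynomial.coeff q i) hp
  simp only [p, Polynomial.finsetSum_coeff, Polynomial.coeff_monomial, Finset.sum_ite_eq',
    Polynomial.coeff_zero] at this
  by_cases hi : i ∈ Finset.range (f.totalDegree + 1)
  · simpa [hi] using this
  · rw [homogeneousComponent_eq_zero, map_zero]
    simpa using hi

/-- The intersection of the ideals of the linear spaces indexed by `T`. -/
noncomputable def arrangementIdeal {ι : Type*} (W : ι → Submodule k (Fin (n + 1) → k))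
    (T : Finset ι) : Ideal (MvPolynomial (Fin (n + 1)) k) :=
  ⨅ i : T, linearSpaceIdeal (W i)

theorem isHomogIdeal_arrangementIdeal {ι : Type*} (W : ι → Submodule k (Fin (n + 1) → k))
    (T : Finset ι) : IsHomogIdeal (arrangementIdeal W T) := by
  intro f hf i
  rw [arrangementIdeal, Ideal.mem_iInf] at *
  exact fun a => isHomogIdeal_linearSpaceIdeal _ f (hf a) i

/-- The socle of `S / (I₁ ∩ ⋯ ∩ I_d + L)` lives in degrees less than `d`. -/
theorem socleBound_arrangementIdeal {ι : Type*} [DecidableEq ι]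
    (W : ι → Submodule k (Fin (n + 1) → k)) (d : ℕ) : ∀ T : Finset ι, T.card = d →
    ∀ L : Ideal (MvPolynomial (Fin (n + 1)) k), IsLinearIdeal L →
      SocleBound (arrangementIdeal W T ⊔ L) d := by
  induction d with
  | zero =>
    intro T hT L _ j _ f _ _
    rw [Finset.card_eq_zero] at hT
    subst hT
    have : arrangementIdeal W ∅ = ⊤ := by simp [arrangementIdeal]
    rw [this, top_sup_eq]
    trivial
  | succ d ih =>
    intro T hT L
    induction L using WellFoundedGT.induction with
    | ind L ihL =>
    intro hL j hj f hf hsoc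
    obtain ⟨j, rfl⟩ : ∃ i, j = i + 1 := ⟨j - 1, by omega⟩
    set I := arrangementIdeal W T with hI
    let Q := (⨆ i : T, linearSpaceIdeal (W i)) ⊔ L
    by_cases hQ : irrelevantMaximalIdeal k n ≤ Q
    · by_cases hmL : irrelevantMaximalIdeal k n ≤ L
      · exact Ideal.mem_sup_right (hmL (hf.mem_irrelevant (by omega)))
      have hJ : ∀ i ∈ T, SocleBound (arrangementIdeal W (T.erase i) ⊔ L) d := fun i hi =>
        ih _ (by rw [Finset.card_erase_of_mem hi, hT]; rfl) L hL
      obtain ⟨l, hl, hlL, hgood⟩ := exists_general_linForm T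
        (fun i => arrangementIdeal W (T.erase i) ⊔ L) hJ hmL
      have hlt : L < L ⊔ Ideal.span {l} := by
        refine lt_of_le_of_ne le_sup_left fun h => hlL ?_
        rw [h]
        exact Ideal.mem_sup_right (Ideal.mem_span_singleton_self l)
      have hmem : f ∈ (I ⊔ L) ⊔ Ideal.span {l} := by
        rw [sup_assoc]
        refine ihL _ hlt (hL.sup_span_singleton hl) _ hj f hf fun a => ?_
        rw [← sup_assoc]
        exact Ideal.mem_sup_left (hsoc a)
      obtain ⟨g, hg, h, hh, rfl⟩ := ((isHomogIdeal_arrangementIdeal W T).sup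
        hL.isHomogIdeal).exists_add_mul hl hf hmem
      -- `l * h` differs from `f` by an element of `I ⊔ L`, so it is again in the socle.
      have hm : ∀ p ∈ irrelevantMaximalIdeal k n, p * (l * h) ∈ I ⊔ L := by
        intro p hp
        have : irrelevantMaximalIdeal k n ≤ Submodule.comap (LinearMap.mulRight _ (l * h)) (I ⊔ L) := by
          refine Ideal.span_le.2 ?_
          rintro _ ⟨a, rfl⟩
          change X a * (l * h) ∈ I ⊔ L
          have := (I ⊔ L).sub_mem (hsoc a) ((I ⊔ L).mul_mem_left (X a) hg)
          rwa [mul_add, add_sub_cancel_left] at this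
        exact this hp
      have hlm : l ∈ irrelevantMaximalIdeal k n := hl.mem_irrelevant one_pos
      have hle : ∀ i, I ≤ arrangementIdeal W (T.erase i) := by
        intro i
        refine le_iInf fun a => ?_
        exact iInf_le (fun i : T => linearSpaceIdeal (W i)) ⟨a.1, Finset.mem_of_mem_erase a.2⟩
      have hhJ : ∀ i ∈ T, h ∈ arrangementIdeal W (T.erase i) ⊔ L := by
        intro i hi
        -- Both `l * h` and `h` have degree at least `d`, so `l` can be cancelled twice from `l * (l
        -- * h)`.
        have h1 := sup_le_sup_right (hle i) L (hm l hlm)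
        have h2 := hgood i hi (j + 1) (by omega) _ (add_comm 1 j ▸ hl.mul hh) h1
        exact hgood i hi j (by omega) _ hh h2
      have hQK : Q ≤ Submodule.comap (LinearMap.mulRight _ h) (I ⊔ L) := by
        refine sup_le (iSup_le fun i => ?_) fun p hp => ?_
        · intro p hp
          change p * h ∈ I ⊔ L
          obtain ⟨u, hu, w, hw, rfl⟩ := Submodule.mem_sup.1 (hhJ i i.2)
          rw [mul_add]
          refine Submodule.add_mem_sup ?_ (L.mul_mem_left p hw)
          rw [hI, arrangementIdeal, Ideal.mem_iInf]
          intro i'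
          by_cases hii : (i' : ι) = i
          · rw [hii]
            exact Ideal.mul_mem_right _ _ hp
          · rw [arrangementIdeal, Ideal.mem_iInf] at hu
            exact Ideal.mul_mem_left _ _ (hu ⟨i', Finset.mem_erase.2 ⟨hii, i'.2⟩⟩)
        · exact Ideal.mem_sup_right (L.mul_mem_right h hp)
      exact (I ⊔ L).add_mem hg (hQK (hQ hlm))
    · obtain ⟨a, ha⟩ : ∃ a, X a ∉ Q := by
        by_contra! h
        refine hQ (Ideal.span_le.2 ?_)
        rintro _ ⟨a, rfl⟩
        exact h a
      obtain ⟨v, hv, hvQ⟩ := exists_eval_ne_zero (isHomogeneous_X k a) ha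
      -- The point `v` lies in every `W i`, since otherwise some linear form of that subspace's
      -- ideal, hence of `Q`, would be nonzero at `v`.
      have hstab : IsTranslationStable v (I ⊔ L) := by
        refine IsTranslationStable.sup (IsTranslationStable.iInf fun i => ?_)
          (hL.isTranslationStable fun f hf => hvQ f (Ideal.mem_sup_right hf))
        refine isTranslationStable_linearSpaceIdeal ?_
        by_contra hvW
        obtain ⟨l, hlW, hl, hlv⟩ := exists_linForm_notVanishing hvW
        exact hlv (hvQ l (Ideal.mem_sup_left
          (Ideal.mem_iSup_of_mem i hlW)) hl)
      exact hstab.mem_of_mul_mem (isHomogeneous_X k a) hv (hsoc a)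

end Arrangements

/-! ### Minimal homogeneous generators -/

section Covers

variable {k : Type*} [Field k] {n r : ℕ}

theorem mem_smul_top_iff {I : Ideal (MvPolynomial (Fin (n + 1)) k)}
    {f : Fin r → MvPolynomial (Fin (n + 1)) k} :
    f ∈ I • (⊤ : Submodule (MvPolynomial (Fin (n + 1)) k) (Fin r → MvPolynomial (Fin (n + 1)) k)) ↔
      ∀ α, f α ∈ I := by
  constructor
  · intro hf α
    induction hf using Submodule.smul_induction_on' with
    | smul g hg v _ => exact I.mul_mem_right _ hg
    | add x _ y _ hx hy => exact I.add_mem hx hy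
  · intro hf
    rw [pi_eq_sum_univ f]
    exact Submodule.sum_mem _ fun α _ => Submodule.smul_mem_smul (hf α) Submodule.mem_top

/-- A submodule of a graded free module containing the homogeneous components of its elements. -/
def IsHomogSubmodule (e : Fin r → ℤ) (N : Submodule (MvPolynomial (Fin (n + 1)) k)
    (Fin r → MvPolynomial (Fin (n + 1)) k)) : Prop :=
  ∀ f ∈ N, ∀ j, freeProj k n e j f ∈ N

theorem IsHomogSubmodule.exists_homogeneous_generators {e : Fin r → ℤ}
    {N : Submodule (MvPolynomial (Fin (n + 1)) k) (Fin r → MvPolynomial (Fin (n + 1)) k)}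
    (hN : IsHomogSubmodule e N) :
    ∃ (m : ℕ) (v : Fin m → Fin r → MvPolynomial (Fin (n + 1)) k) (e' : Fin m → ℤ),
      (∀ a, v a ∈ freeDegreePart k n e (e' a)) ∧
        Submodule.span (MvPolynomial (Fin (n + 1)) k) (Set.range v) = N := by
  classical
  obtain ⟨s, rfl⟩ : N.FG := IsNoetherian.noetherian N
  choose J hJ using fun f : Fin r → MvPolynomial (Fin (n + 1)) k => exists_sum_freeProj e f
  let t : Finset (Fin r → MvPolynomial (Fin (n + 1)) k) :=
    s.biUnion fun f => (J f).image fun j => freeProj k n e j f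
  have ht : ∀ x ∈ t, ∃ f ∈ s, ∃ j, freeProj k n e j f = x := by
    intro x hx
    obtain ⟨f, hf, hx⟩ := Finset.mem_biUnion.1 hx
    obtain ⟨j, -, hj⟩ := Finset.mem_image.1 hx
    exact ⟨f, hf, j, hj⟩
  choose! F hF j hj using ht
  refine ⟨t.card, fun a => t.equivFin.symm a, fun a => j (t.equivFin.symm a), fun a => ?_, ?_⟩
  · have h := hj _ (t.equivFin.symm a).2
    have h' := freeProj_mem (k := k) (n := n) (e := e) (j (t.equivFin.symm a))
      (F (t.equivFin.symm a))
    rwa [h] at h'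
  · have hrange : Set.range (fun a => (t.equivFin.symm a : Fin r → MvPolynomial (Fin (n + 1)) k)) =
        t := by
      ext x
      constructor
      · rintro ⟨a, rfl⟩
        exact (t.equivFin.symm a).2
      · intro hx
        exact ⟨t.equivFin ⟨x, hx⟩, by simp⟩
    rw [hrange]
    apply le_antisymm
    · refine Submodule.span_le.2 fun x hx => ?_
      rw [← hj x hx]
      exact hN _ (Submodule.subset_span (hF x hx)) _
    · refine Submodule.span_le.2 fun f hf => ?_
      have h : ∑ j ∈ J f, freeProj k n e j f ∈
          Submodule.span (MvPolynomial (Fin (n + 1)) k) (t : Set (Fin r → _)) := by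
        refine Submodule.sum_mem _ fun j hj => Submodule.subset_span ?_
        exact Finset.mem_biUnion.2 ⟨f, hf, Finset.mem_image_of_mem _ hj⟩
      rwa [hJ] at h

theorem freeProj_sum_smul {e : Fin r → ℤ} {m : ℕ}
    {v : Fin m → Fin r → MvPolynomial (Fin (n + 1)) k} {e' : Fin m → ℤ}
    (hv : ∀ a, v a ∈ freeDegreePart k n e (e' a)) (j : ℤ)
    (g : Fin m → MvPolynomial (Fin (n + 1)) k) :
    freeProj k n e j (∑ b, g b • v b) = ∑ b, freeProj k n e' j g b • v b := by
  rw [map_sum]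
  exact Finset.sum_congr rfl fun b _ => freeProj_smul_right (hv b) j (g b)

/-- A homogeneous submodule has a finite family of homogeneous generators all of whose relations
have coefficients in the irrelevant ideal. -/
theorem IsHomogSubmodule.exists_minimal_generators {e : Fin r → ℤ}
    {N : Submodule (MvPolynomial (Fin (n + 1)) k) (Fin r → MvPolynomial (Fin (n + 1)) k)}
    (hN : IsHomogSubmodule e N) :
    ∃ (m : ℕ) (v : Fin m → Fin r → MvPolynomial (Fin (n + 1)) k) (e' : Fin m → ℤ),
      (∀ a, v a ∈ freeDegreePart k n e (e' a)) ∧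
        Submodule.span (MvPolynomial (Fin (n + 1)) k) (Set.range v) = N ∧
        ∀ g : Fin m → MvPolynomial (Fin (n + 1)) k, ∑ b, g b • v b = 0 →
          ∀ a, (g a).coeff 0 = 0 := by
  classical
  have hex := hN.exists_homogeneous_generators
  obtain ⟨v, e', hv, hspan⟩ := Nat.find_spec hex
  have hmin := fun m => Nat.find_min hex (m := m)
  generalize Nat.find hex = m at v e' hv hspan hmin
  refine ⟨m, v, e', hv, hspan, fun g hg a => ?_⟩
  by_contra hc
  obtain ⟨m, rfl⟩ : ∃ m', m = m' + 1 := ⟨m - 1, by have := a.2; omega⟩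
  refine hmin m (by omega) ⟨v ∘ a.succAbove, e' ∘ a.succAbove, fun b => hv _, ?_⟩
  rw [← hspan]
  apply le_antisymm
  · exact Submodule.span_mono (Set.range_comp_subset_range _ _)
  · refine Submodule.span_le.2 ?_
    rintro _ ⟨b, rfl⟩
    by_cases hb : b = a
    · subst hb
      -- In the degree `e' b` part of the relation, `v b` has the nonzero constant term of `g b` as
      -- coefficient, so `v b` is redundant, against the minimal choice of `m`.
      have h := freeProj_sum_smul hv (e' b) g
      rw [hg, map_zero, Fin.sum_univ_succAbove _ b, freeProj_apply, sub_self] at h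
      have h0 : polyProj k n 0 (g b) = C ((g b).coeff 0) := by
        have := polyProj_natCast (k := k) (n := n) 0
        rw [Nat.cast_zero] at this
        rw [this, homogeneousComponent_zero]
      rw [h0] at h
      have h1 : v b = -(C ((g b).coeff 0)⁻¹ : MvPolynomial (Fin (n + 1)) k) •
          ∑ i, freeProj k n e' (e' b) g (b.succAbove i) • v (b.succAbove i) := by
        rw [neg_smul, ← smul_neg, ← eq_neg_of_add_eq_zero_left h.symm, smul_smul, ← map_mul,
          inv_mul_cancel₀ hc, map_one, one_smul]
      rw [SetLike.mem_coe, h1]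
      refine Submodule.smul_mem _ _ (Submodule.sum_mem _ fun i _ => Submodule.smul_mem _ _ ?_)
      exact Submodule.subset_span ⟨i, rfl⟩
    · obtain ⟨i, rfl⟩ := Fin.exists_succAbove_eq hb
      exact Submodule.subset_span ⟨i, rfl⟩

end Covers

/-! ### Flags of linear forms and syzygies -/

section Flags

variable {k : Type*} [Field k] {n r : ℕ}

/-- The last member of a flag of ideals, starting from zero, each obtained from the previous one by
adding a new linear form satisfying a condition `Q`. -/
inductive LinearFlag
    (Q : Ideal (MvPolynomial (Fin (n + 1)) k) → MvPolynomial (Fin (n + 1)) k → Prop) :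
    Ideal (MvPolynomial (Fin (n + 1)) k) → Prop
  | bot : LinearFlag Q ⊥
  | snoc (Λ : Ideal (MvPolynomial (Fin (n + 1)) k)) (l : MvPolynomial (Fin (n + 1)) k) :
      LinearFlag Q Λ → l.IsHomogeneous 1 → l ∉ Λ → Q Λ l → LinearFlag Q (Λ ⊔ Ideal.span {l})

theorem LinearFlag.isLinearIdeal
    {Q : Ideal (MvPolynomial (Fin (n + 1)) k) → MvPolynomial (Fin (n + 1)) k → Prop}
    {Λ : Ideal (MvPolynomial (Fin (n + 1)) k)} (h : LinearFlag Q Λ) : IsLinearIdeal Λ := by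
  induction h with
  | bot => exact isLinearIdeal_bot
  | snoc Λ l _ hl _ _ ih => exact ih.sup_span_singleton hl

/-- By Noetherianity some flag has a maximal last member; it must contain `𝔪`, or else the flag
could be extended. -/
theorem exists_linearFlag_irrelevant
    {Q : Ideal (MvPolynomial (Fin (n + 1)) k) → MvPolynomial (Fin (n + 1)) k → Prop}
    (hQ : ∀ Λ, IsLinearIdeal Λ → ¬ irrelevantMaximalIdeal k n ≤ Λ →
      ∃ l, l.IsHomogeneous 1 ∧ l ∉ Λ ∧ Q Λ l) :
    LinearFlag Q (irrelevantMaximalIdeal k n) := by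
  obtain ⟨Λ, hΛ, hmax⟩ := WellFounded.has_min
    (wellFounded_gt (α := Ideal (MvPolynomial (Fin (n + 1)) k))) {Λ | LinearFlag Q Λ} ⟨⊥, .bot⟩
  by_cases h : irrelevantMaximalIdeal k n ≤ Λ
  · rwa [le_antisymm h hΛ.isLinearIdeal.le_irrelevant]
  · obtain ⟨l, hl, hlΛ, hlQ⟩ := hQ Λ hΛ.isLinearIdeal h
    refine absurd ?_ (hmax _ (LinearFlag.snoc Λ l hΛ hl hlΛ hlQ))
    refine lt_of_le_of_ne le_sup_left fun heq => hlΛ ?_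
    rw [heq]
    exact Ideal.mem_sup_right (Ideal.mem_span_singleton_self l)

/-- Multiplication by `l` is injective in degrees greater than `ρ` on the quotient of `F / N`
by `Λ`, where `F` is the graded free module with generators in degrees `e`. -/
def InjectiveAbove (e : Fin r → ℤ) (N : Submodule (MvPolynomial (Fin (n + 1)) k)
    (Fin r → MvPolynomial (Fin (n + 1)) k)) (ρ : ℤ) (Λ : Ideal (MvPolynomial (Fin (n + 1)) k))
    (l : MvPolynomial (Fin (n + 1)) k) : Prop :=
  ∀ j, ρ < j → ∀ f ∈ freeDegreePart k n e j, l • f ∈ N ⊔ Λ • ⊤ → f ∈ N ⊔ Λ • ⊤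

variable {e : Fin r → ℤ} {N : Submodule (MvPolynomial (Fin (n + 1)) k)
    (Fin r → MvPolynomial (Fin (n + 1)) k)} {ρ : ℤ}

theorem freeProj_mem_smul_top {Λ : Ideal (MvPolynomial (Fin (n + 1)) k)} (hΛ : IsHomogIdeal Λ)
    {f : Fin r → MvPolynomial (Fin (n + 1)) k}
    (hf : f ∈ Λ • (⊤ : Submodule (MvPolynomial (Fin (n + 1)) k) _)) (j : ℤ) :
    freeProj k n e j f ∈ Λ • (⊤ : Submodule (MvPolynomial (Fin (n + 1)) k) _) := by
  rw [mem_smul_top_iff] at *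
  intro α
  rw [freeProj_apply, polyProj]
  split_ifs
  · exact hΛ _ (hf α) _
  · simp

/-- This is the vanishing of `Tor₁(F / N, S / Λ)` in degrees above `ρ + 1`. Writing `f = u + l g`
with `u ∈ ΛF`, the form `g` has degree `j - 1 > ρ`, so injectivity puts it in `N + ΛF`; subtracting
`l` times its `N`-part from `f` leaves an element of `N ∩ ΛF` for the smaller `Λ`. -/
theorem LinearFlag.mem_smul_of_mem (hN : IsHomogSubmodule e N)
    {Λ : Ideal (MvPolynomial (Fin (n + 1)) k)} (h : LinearFlag (InjectiveAbove e N ρ) Λ) :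
    ∀ j, ρ + 1 < j → ∀ f ∈ freeDegreePart k n e j, f ∈ N →
      f ∈ Λ • (⊤ : Submodule (MvPolynomial (Fin (n + 1)) k) _) → f ∈ Λ • N := by
  induction h with
  | bot =>
    intro j _ f _ _ hf
    rw [Submodule.bot_smul] at hf ⊢
    exact hf
  | snoc Λ l hΛ hl hlΛ hQ ih =>
    intro j hj f hfj hfN hf
    have hlin := hΛ.isLinearIdeal.isHomogIdeal
    rw [Submodule.sup_smul] at hf
    obtain ⟨u, hu, x, hx, hux⟩ := Submodule.mem_sup.1 hf
    rw [Submodule.ideal_span_singleton_smul] at hx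
    obtain ⟨g, -, rfl⟩ := Submodule.mem_smul_pointwise_iff_exists _ _ _ |>.1 hx
    have hl1 : l ∈ polyDegreePart k n 1 := by exact_mod_cast hl.mem_polyDegreePart
    have hf' : freeProj k n e j u + l • freeProj k n e (j - 1) g = f := by
      rw [← freeProj_smul hl1, ← map_add, hux, freeProj_of_mem hfj]
    have hu' := freeProj_mem_smul_top (e := e) hlin hu j
    have hgmem : freeProj k n e (j - 1) g ∈ N ⊔ Λ • ⊤ := by
      refine hQ (j - 1) (by omega) _ (freeProj_mem _ _) ?_
      rw [← sub_eq_of_eq_add' hf'.symm]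
      exact Submodule.sub_mem _ (Submodule.mem_sup_left hfN) (Submodule.mem_sup_right hu')
    obtain ⟨p, hp, w, hw, hpw⟩ := Submodule.mem_sup.1 hgmem
    set p' := freeProj k n e (j - 1) p
    have hp' : p' ∈ N := hN p hp _
    have hw' := freeProj_mem_smul_top (e := e) hlin hw (j - 1)
    have hpw' : p' + freeProj k n e (j - 1) w = freeProj k n e (j - 1) g := by
      rw [← map_add, hpw, freeProj_of_mem (freeProj_mem _ _)]
    have hlp : l • p' ∈ freeDegreePart k n e j := by
      have := smul_mem_freeDegreePart hl1 (freeProj_mem (e := e) (j - 1) p)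
      rwa [add_sub_cancel] at this
    have hrest : f - l • p' ∈ Λ • N := by
      refine ih j hj _ (Submodule.sub_mem _ hfj hlp) (N.sub_mem hfN (N.smul_mem l hp')) ?_
      have : f - l • p' = freeProj k n e j u + l • freeProj k n e (j - 1) w := by
        rw [← hf', ← hpw', smul_add]
        abel
      rw [this]
      exact Submodule.add_mem _ hu' (Submodule.smul_mem _ _ hw')
    rw [Submodule.sup_smul, ← sub_add_cancel f (l • p')]
    refine Submodule.add_mem_sup hrest ?_
    exact Submodule.smul_mem_smul (Ideal.mem_span_singleton_self l) hp'

/-- The condition on flags passes from a graded module to its syzygies. -/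
theorem LinearFlag.ker (hN : IsHomogSubmodule e N) {m : ℕ} {e' : Fin m → ℤ}
    (φ : (Fin m → MvPolynomial (Fin (n + 1)) k) →ₗ[MvPolynomial (Fin (n + 1)) k]
      (Fin r → MvPolynomial (Fin (n + 1)) k))
    (hφ : ∀ j, ∀ v ∈ freeDegreePart k n e' j, φ v ∈ freeDegreePart k n e j)
    (hrange : LinearMap.range φ = N)
    {Λ : Ideal (MvPolynomial (Fin (n + 1)) k)} (h : LinearFlag (InjectiveAbove e N ρ) Λ) :
    LinearFlag (InjectiveAbove e' (LinearMap.ker φ) (ρ + 1)) Λ := by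
  induction h with
  | bot => exact .bot
  | snoc Λ l hΛ hl hlΛ hQ ih =>
    refine .snoc Λ l ih hl hlΛ fun j hj g hg hlg => ?_
    have hmap : (Λ • (⊤ : Submodule (MvPolynomial (Fin (n + 1)) k) _)).map φ = Λ • N := by
      rw [Submodule.map_smul'', Submodule.map_top, hrange]
    have hlφ : l • φ g ∈ Λ • N := by
      obtain ⟨p, hp, w, hw, hpw⟩ := Submodule.mem_sup.1 hlg
      rw [← map_smul, ← hpw, map_add, LinearMap.mem_ker.1 hp, zero_add, ← hmap]
      exact Submodule.mem_map_of_mem hw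
    -- As `l` is a nonzerodivisor modulo `Λ`, `φ g` lies in `N ∩ ΛF`, which equals `ΛN` in this
    -- degree.
    have hφg : φ g ∈ Λ • N := by
      refine hΛ.mem_smul_of_mem hN j hj _ (hφ j g hg) (hrange ▸ LinearMap.mem_range_self φ g) ?_
      have := Submodule.smul_mono (le_refl Λ) le_top hlφ
      rw [mem_smul_top_iff] at this ⊢
      exact fun α => hΛ.isLinearIdeal.mem_of_mul_mem hl hlΛ (this α)
    rw [← hmap] at hφg
    obtain ⟨w, hw, hwg⟩ := hφg
    rw [← sub_add_cancel g w]
    refine Submodule.add_mem_sup ?_ hw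
    rw [LinearMap.mem_ker, map_sub, hwg, sub_self]

/-- Above degree `ρ + 1` every coordinate of `f` has positive degree, so `f ∈ 𝔪F`. By Nakayama the
conclusion says that `N` is generated in degrees at most `ρ + 1`. -/
theorem LinearFlag.mem_irrelevant_smul (hN : IsHomogSubmodule e N) (he : ∀ α, e α ≤ ρ + 1)
    (h : LinearFlag (InjectiveAbove e N ρ) (irrelevantMaximalIdeal k n)) {j : ℤ} (hj : ρ + 1 < j)
    {f : Fin r → MvPolynomial (Fin (n + 1)) k} (hf : f ∈ freeDegreePart k n e j) (hfN : f ∈ N) :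
    f ∈ irrelevantMaximalIdeal k n • N := by
  refine h.mem_smul_of_mem hN j hj f hf hfN (mem_smul_top_iff.2 fun α => ?_)
  rcases mem_polyDegreePart_iff.1 (mem_freeDegreePart_iff.1 hf α) with h0 | ⟨i, hi, hfi⟩
  · rw [h0]
    exact Ideal.zero_mem _
  · have := he α
    exact hfi.mem_irrelevant (by omega)

end Flags

/-! ### Construction of the minimal resolution -/

section Resolution

/-- A homogeneous submodule of a graded free module arising in a linear resolution. -/
structure SyzygyStage (k : Type*) [Field k] (n : ℕ) (ρ : ℤ) where
  /-- the rank of the ambient free module -/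
  rank : ℕ
  /-- the degrees of the generators of the ambient free module -/
  deg : Fin rank → ℤ
  /-- the submodule -/
  sub : Submodule (MvPolynomial (Fin (n + 1)) k) (Fin rank → MvPolynomial (Fin (n + 1)) k)
  homog : IsHomogSubmodule deg sub
  deg_le : ∀ α, deg α ≤ ρ + 1
  flag : LinearFlag (InjectiveAbove deg sub ρ) (irrelevantMaximalIdeal k n)

variable {k : Type*} [Field k] {n : ℕ}

theorem SyzygyStage.exists_cover {ρ ρ' : ℤ} (hρ : ρ' = ρ + 1) (s : SyzygyStage k n ρ) :
    ∃ (t : SyzygyStage k n ρ') (φ : (Fin t.rank → MvPolynomial (Fin (n + 1)) k)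
        →ₗ[MvPolynomial (Fin (n + 1)) k] (Fin s.rank → MvPolynomial (Fin (n + 1)) k)),
      LinearMap.range φ = s.sub ∧ LinearMap.ker φ = t.sub ∧
      (∀ j, ∀ v ∈ freeDegreePart k n t.deg j, φ v ∈ freeDegreePart k n s.deg j) ∧
      t.sub ≤ irrelevantMaximalIdeal k n • ⊤ ∧ ∀ α, t.deg α ≤ ρ + 1 := by
  subst hρ
  obtain ⟨m, v, e', hv, hspan, hmin⟩ := s.homog.exists_minimal_generators
  let φ := Fintype.linearCombination (MvPolynomial (Fin (n + 1)) k) v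
  have hφ : ∀ g, φ g = ∑ b, g b • v b := fun g => Fintype.linearCombination_apply _ _ _
  have hrange : LinearMap.range φ = s.sub := by
    rw [← hspan]
    exact Fintype.range_linearCombination _ _
  have hproj : ∀ j g, freeProj k n s.deg j (φ g) = φ (freeProj k n e' j g) := by
    intro j g
    rw [hφ, hφ, freeProj_sum_smul hv]
  have hgr : ∀ j, ∀ g ∈ freeDegreePart k n e' j, φ g ∈ freeDegreePart k n s.deg j := by
    intro j g hg
    rw [← freeProj_of_mem hg, ← hproj]
    exact freeProj_mem _ _
  have hdeg : ∀ α, e' α ≤ ρ + 1 := by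
    intro α
    by_contra! hα
    have hvα : v α ∈ s.sub := hspan ▸ Submodule.subset_span ⟨α, rfl⟩
    have hmem := s.flag.mem_irrelevant_smul s.homog s.deg_le hα (hv α) hvα
    rw [← hrange, ← Submodule.map_top, ← Submodule.map_smul''] at hmem
    -- Writing `v α` with coefficients `g` in `𝔪` gives a relation whose coefficient at `α` has
    -- constant term `-1`, contradicting minimality.
    obtain ⟨g, hg, hgv⟩ := hmem
    have hg0 := mem_irrelevantMaximalIdeal_iff.1 (mem_smul_top_iff.1 hg α)
    have h := hmin (g - Pi.single α 1) (by
      rw [← hφ, map_sub, hgv, Fintype.linearCombination_apply_single, one_smul, sub_self]) α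
    simp [hg0] at h
  refine ⟨⟨m, e', LinearMap.ker φ, ?_, fun α => (hdeg α).trans (by omega),
    s.flag.ker s.homog φ hgr hrange⟩, φ, hrange, rfl, hgr, ?_, hdeg⟩
  · intro g hg j
    rw [LinearMap.mem_ker, ← hproj, LinearMap.mem_ker.1 hg, map_zero]
  · intro g hg
    rw [mem_smul_top_iff]
    intro α
    rw [mem_irrelevantMaximalIdeal_iff]
    exact hmin g (by rw [← hφ]; exact hg) α

/-- If `S / (K + Λ)` has socle in degrees less than `r` for all ideals `Λ` generated by linear
forms, then the homogeneous ideal `K` is `r`-regular. -/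
theorem isCMRegularIdeal_of_socleBound [Infinite k] {K : Ideal (MvPolynomial (Fin (n + 1)) k)}
    (hK : IsHomogIdeal K) {r : ℕ} (hsoc : ∀ Λ, IsLinearIdeal Λ → SocleBound (K ⊔ Λ) r) :
    IsCMRegularIdeal K r := by
  let N : Submodule (MvPolynomial (Fin (n + 1)) k) (Fin 1 → MvPolynomial (Fin (n + 1)) k) :=
    Submodule.comap (LinearMap.proj 0) K
  have hN : ∀ f, f ∈ N ↔ f 0 ∈ K := fun f => Iff.rfl
  have hNΛ : ∀ (Λ : Ideal (MvPolynomial (Fin (n + 1)) k)) f, f ∈ N ⊔ Λ • ⊤ ↔ f 0 ∈ K ⊔ Λ := by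
    intro Λ f
    constructor
    · intro hf
      obtain ⟨p, hp, w, hw, rfl⟩ := Submodule.mem_sup.1 hf
      exact Submodule.add_mem_sup hp (mem_smul_top_iff.1 hw 0)
    · intro hf
      obtain ⟨p, hp, w, hw, hpw⟩ := Submodule.mem_sup.1 hf
      refine Submodule.mem_sup.2 ⟨fun _ => p, hp, fun _ => w, mem_smul_top_iff.2 fun _ => hw, ?_⟩
      ext1 α
      rw [Subsingleton.elim α 0]
      exact hpw
  -- With bound `r - 1 + i` at stage `i`, the free cover of that stage has generators in degrees at
  -- most `r + i`. Stage `0` is `K` inside `S`.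
  let s₀ : SyzygyStage k n (r - 1 + (0 : ℕ)) :=
    { rank := 1
      deg := 0
      sub := N
      homog := by
        intro f hf j
        rw [hN, freeProj_apply, polyProj]
        split_ifs
        · exact hK _ hf _
        · simp
      deg_le := fun α => by simp
      flag := by
        refine exists_linearFlag_irrelevant fun Λ hΛ hm => ?_
        obtain ⟨l, hl, hlΛ, hgood⟩ := exists_general_linForm (Finset.univ : Finset Unit)
          (fun _ => K ⊔ Λ) (fun _ _ => hsoc Λ hΛ) hm
        refine ⟨l, hl, hlΛ, fun j hj f hf hlf => ?_⟩
        rw [hNΛ] at hlf ⊢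
        lift j to ℕ using by omega
        refine hgood () (Finset.mem_univ _) j (by omega) (f 0) ?_ hlf
        have := mem_freeDegreePart_iff.1 hf 0
        rw [Pi.zero_apply, sub_zero] at this
        exact isHomogeneous_of_mem_polyDegreePart this }
  choose next φ hrange hker hgr hmin hdeg using fun (i : ℕ) (s : SyzygyStage k n (r - 1 + i)) =>
    s.exists_cover (ρ' := r - 1 + (i + 1 : ℕ)) (by push_cast; ring)
  let st : (i : ℕ) → SyzygyStage k n (r - 1 + i) := fun i => Nat.rec s₀ next i
  have hmemK : ∀ g, φ 0 (st 0) g 0 ∈ K := fun g =>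
    (hN _).1 ((hrange 0 (st 0)).le (LinearMap.mem_range_self _ g))
  let aug : (Fin (st 1).rank → MvPolynomial (Fin (n + 1)) k)
      →ₗ[MvPolynomial (Fin (n + 1)) k] K :=
    LinearMap.codRestrict K (LinearMap.proj 0 ∘ₗ φ 0 (st 0)) hmemK
  have haug : LinearMap.ker aug = (st 1).sub := by
    refine Eq.trans ?_ (hker 0 (st 0))
    ext g
    rw [LinearMap.mem_ker, LinearMap.mem_ker]
    constructor
    · intro h
      ext1 α
      obtain rfl : α = (0 : Fin 1) := Subsingleton.elim (α := Fin 1) α 0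
      exact congrArg Subtype.val h
    · intro h
      exact Subtype.ext (congrFun h 0)
  -- The shift by one discards the ambient `S` of stage `0`: `F_i` is the cover of stage `i`, which
  -- is the ambient module of stage `i + 1`.
  refine ⟨
    { rank := fun i => (st (i + 1)).rank
      deg := fun i => (st (i + 1)).deg
      aug := aug
      diff := fun i => φ (i + 1) (st (i + 1))
      aug_graded := ?_
      diff_graded := fun i => hgr (i + 1) (st (i + 1))
      aug_surjective := ?_
      exact_zero := ?_
      exact_succ := ?_
      minimal := ?_ }, ?_⟩
  · intro j v hv
    have := mem_freeDegreePart_iff.1 (hgr 0 (st 0) j v hv) 0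
    change _ ∈ polyDegreePart k n (j - 0) at this
    rw [sub_zero] at this
    exact this
  · rintro ⟨p, hp⟩
    have h : (fun _ => p) ∈ LinearMap.range (φ 0 (st 0)) := (hrange 0 (st 0)).ge hp
    obtain ⟨g, hg⟩ := h
    exact ⟨g, Subtype.ext (congrFun hg 0)⟩
  · rw [LinearMap.exact_iff, haug]
    exact (hrange 1 (st 1)).symm
  · intro i
    rw [LinearMap.exact_iff]
    exact (hker (i + 1) (st (i + 1))).trans (hrange (i + 2) (st (i + 2))).symm
  · intro i
    exact (hrange (i + 1) (st (i + 1))).le.trans (hmin i (st i))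
  · intro i α
    refine (hdeg i (st i) α).trans ?_
    omega

end Resolution

theorem proposition2p2 (k : Type*) [Field k] [Infinite k] (n d : ℕ)
    (W : Fin d → Submodule k (Fin (n + 1) → k))
    (L : Ideal (MvPolynomial (Fin (n + 1)) k)) (hL : IsLinearIdeal L) :
    IsCMRegularIdeal ((⨅ i, linearSpaceIdeal (W i)) ⊔ L) (d : ℤ) := by
  have hI : arrangementIdeal W Finset.univ = ⨅ i, linearSpaceIdeal (W i) := by
    refine le_antisymm (le_iInf fun i => ?_) (le_iInf fun i => iInf_le _ _)
    exact iInf_le (fun i : (Finset.univ : Finset (Fin d)) => linearSpaceIdeal (W i))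
      ⟨i, Finset.mem_univ i⟩
  rw [← hI]
  refine isCMRegularIdeal_of_socleBound
    ((isHomogIdeal_arrangementIdeal W _).sup hL.isHomogIdeal) fun Λ hΛ => ?_
  rw [sup_assoc]
  refine socleBound_arrangementIdeal W d _ (by simp) _ ?_
  obtain ⟨s, hs, rfl⟩ := hL
  obtain ⟨t, ht, rfl⟩ := hΛ
  exact ⟨s ∪ t, fun f hf => hf.elim (hs f) (ht f), (Ideal.span_union _ _).symm⟩
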